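/- Let $T$ be a finite tree (with at least one vertex). Let $\gamma(T)$ be its domination number, i.e. the smallest size of a set $D$ of vertices such that every vertex of $T$ is in $D$ or adjacent to a vertex in $D$. Let $\mu(T)$ be the number, counted with multiplicity, of eigenvalues in the interval $[0,1)$ of the Laplacian matrix $L(T) = D(T) - A(T)$, where $D(T)$ is the diagonal matrix of vertex degrees and $A(T)$ is the adjacency matrix. Then $$1 \le \frac{\gamma(T)}{\mu(T)} < \frac{4}{3}.$$ -/

import Mathlib

namespace SimpleGraph

/-- A set `D` of vertices is dominating if every vertex is in `D` or adjacent to a vertex in `D`. -/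
def IsDominatingSet {V : Type*} (G : SimpleGraph V) (D : Finset V) : Prop :=
  ∀ v : V, v ∈ D ∨ ∃ u ∈ D, G.Adj v u

/-- The domination number `γ(G)`: the size of a smallest dominating set.
(For finite `V`, the whole vertex set is dominating, so the infimum is attained.) -/
noncomputable def dominationNumber {V : Type*} (G : SimpleGraph V) : ℕ :=
  sInf {k : ℕ | ∃ D : Finset V, G.IsDominatingSet D ∧ D.card = k}

open Classical in
/-- `m_G I`: the number of eigenvalues, counted with multiplicity, of the real Laplacian matrix
of `G` that lie in the set `I`. -/
noncomputable def lapEigenvalueCount {V : Type*} [Fintype V] [DecidableEq V]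
    (G : SimpleGraph V) [DecidableRel G.Adj] (I : Set ℝ) : ℕ :=
  (Finset.univ.filter fun i : V => (G.isHermitian_lapMatrix ℝ).eigenvalues i ∈ I).card

/-- `μ(G) = m_G [0,1)`. -/
noncomputable def lapMu {V : Type*} [Fintype V] [DecidableEq V]
    (G : SimpleGraph V) [DecidableRel G.Adj] : ℕ :=
  G.lapEigenvalueCount (Set.Ico 0 1)

end SimpleGraph

/-! Both bounds concern the form of `L - 1`, whose negative index is `μ`. If `D` is dominating, the
form is nonnegative on vectors vanishing on `D`, so `μ ≤ γ` (`lapMu_le_card`).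

For the upper bound, leaves are stripped from the tree. Completing the square at a leaf of weight
`a` adds `1 - 1/a` to its neighbour's weight, and `a < 0` yields a negative direction. When `a = 0`
and the neighbour's weight is finite, a hyperbolic plane yields one negative direction and the
neighbour's coordinate is then forced to vanish. In parallel a dominating set is built greedily.
Each vertex carries a budget, passed along when it is stripped: a negative direction earns 4, a
chosen vertex costs 3. The weights are a function of class and budget for which every move is
affordable, and the root leaves one unit over: `3γ + 1 ≤ 4μ` (`LeafBuilt.exists_dominatesClasses`).
-/

/-! ### Eigenvalues below 1 and definiteness on subspaces -/

namespace Matrix.IsHermitian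

variable {n : Type*} [Fintype n] [DecidableEq n] {A : Matrix n n ℝ}

theorem exists_diagonalizing_equiv (hA : A.IsHermitian) :
    ∃ U : (n → ℝ) ≃ₗ[ℝ] (n → ℝ), ∀ x,
      x ⬝ᵥ A.mulVec x - x ⬝ᵥ x = ∑ i, (hA.eigenvalues i - 1) * (U x i) ^ 2 := by
  set W : Matrix n n ℝ := (hA.eigenvectorUnitary : Matrix n n ℝ) with hW
  have h1 : star W * W = 1 := Unitary.coe_star_mul_self hA.eigenvectorUnitary
  have h2 : W * star W = 1 := Unitary.coe_mul_star_self hA.eigenvectorUnitary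
  have hs : star W = W.transpose := by
    ext i j; simp [Matrix.star_apply]
  have hspec : A = W * Matrix.diagonal hA.eigenvalues * star W := by
    have := hA.spectral_theorem
    rw [Unitary.conjStarAlgAut_apply] at this
    exact this
  refine ⟨LinearEquiv.ofLinearMap (Matrix.toLin' (star W)) (Matrix.toLin' W) ?_ ?_, fun x => ?_⟩
  · rw [← Matrix.toLin'_mul, h1, Matrix.toLin'_one]
  · rw [← Matrix.toLin'_mul, h2, Matrix.toLin'_one]
  · simp only [LinearEquiv.coe_ofLinearMap, Matrix.toLin'_apply]
    set y := (star W).mulVec x with hy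
    have hx : x = W.mulVec y := by
      rw [hy, Matrix.mulVec_mulVec, h2, Matrix.one_mulVec]
    have e1 : x ⬝ᵥ A.mulVec x = y ⬝ᵥ (Matrix.diagonal hA.eigenvalues).mulVec y := by
      conv_lhs => rw [hspec, ← Matrix.mulVec_mulVec, ← Matrix.mulVec_mulVec, ← hy,
        Matrix.dotProduct_mulVec, ← Matrix.mulVec_transpose, ← hs, ← hy]
    have e2 : x ⬝ᵥ x = y ⬝ᵥ y := by
      conv_lhs => rw [hx, Matrix.dotProduct_mulVec, ← Matrix.mulVec_transpose, ← hs,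
        Matrix.mulVec_mulVec, h1, Matrix.one_mulVec]
    rw [e1, e2]
    simp only [dotProduct, Matrix.mulVec_diagonal, ← Finset.sum_sub_distrib]
    exact Finset.sum_congr rfl fun i _ => by ring

open Classical in
theorem le_card_eigenvalues_lt_one (hA : A.IsHermitian) {k : ℕ}
    (Φ : (Fin k → ℝ) →ₗ[ℝ] (n → ℝ))
    (hΦ : ∀ w, w ≠ 0 → Φ w ⬝ᵥ A.mulVec (Φ w) - Φ w ⬝ᵥ Φ w < 0) :
    k ≤ (Finset.univ.filter fun i => hA.eigenvalues i < 1).card := by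
  obtain ⟨U, hU⟩ := hA.exists_diagonalizing_equiv
  by_contra! hlt
  set s := Finset.univ.filter fun i => hA.eigenvalues i < 1 with hs
  let f : (Fin k → ℝ) →ₗ[ℝ] (s → ℝ) :=
    LinearMap.pi fun i => LinearMap.proj i.1 ∘ₗ U.toLinearMap ∘ₗ Φ
  have hker : LinearMap.ker f ≠ ⊥ := by
    apply LinearMap.ker_ne_bot_of_finrank_lt
    simpa using hlt
  obtain ⟨w, hw, hw0⟩ := (Submodule.ne_bot_iff _).1 hker
  have := hΦ w hw0
  rw [hU] at this
  refine this.not_ge (Finset.sum_nonneg fun i _ => ?_)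
  by_cases hi : hA.eigenvalues i < 1
  · have : U (Φ w) i = 0 := congrFun (LinearMap.mem_ker.1 hw) ⟨i, by simp [hs, hi]⟩
    simp [this]
  · exact mul_nonneg (by linarith) (sq_nonneg _)

open Classical in
-- If the eigenvectors below 1 spanned more than `D.card` dimensions, some nonzero combination would
-- vanish on `D`, yet the form is negative there.
theorem card_eigenvalues_lt_one_le (hA : A.IsHermitian) (D : Finset n)
    (hD : ∀ x : n → ℝ, (∀ i ∈ D, x i = 0) → 0 ≤ x ⬝ᵥ A.mulVec x - x ⬝ᵥ x) :
    (Finset.univ.filter fun i => hA.eigenvalues i < 1).card ≤ D.card := by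
  obtain ⟨U, hU⟩ := hA.exists_diagonalizing_equiv
  by_contra! hlt
  set s := Finset.univ.filter fun i => hA.eigenvalues i < 1 with hs
  let g : (s → ℝ) →ₗ[ℝ] (n → ℝ) := Function.ExtendByZero.linearMap ℝ (Subtype.val : s → n)
  let f : (s → ℝ) →ₗ[ℝ] (D → ℝ) :=
    LinearMap.pi fun i => LinearMap.proj i.1 ∘ₗ U.symm.toLinearMap ∘ₗ g
  have hker : LinearMap.ker f ≠ ⊥ := by
    apply LinearMap.ker_ne_bot_of_finrank_lt
    simpa using hlt
  obtain ⟨w, hw, hw0⟩ := (Submodule.ne_bot_iff _).1 hker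
  have hnn := hD (U.symm (g w)) fun i hi => congrFun (LinearMap.mem_ker.1 hw) ⟨i, hi⟩
  have hg : ∀ i : s, g w i = w i := fun i =>
    Function.Injective.extend_apply (f := (Subtype.val : s → n)) Subtype.val_injective w 0 i
  have hg0 : ∀ i, i ∉ s → g w i = 0 := fun i hi =>
    Function.extend_apply' (f := (Subtype.val : s → n)) w 0 i (by rintro ⟨a, ha⟩; exact hi (ha ▸ a.2))
  rw [hU, LinearEquiv.apply_symm_apply] at hnn
  obtain ⟨i, hi⟩ := Function.ne_iff.1 hw0
  refine hnn.not_gt (Finset.sum_neg' (fun j _ => ?_) ⟨i.1, Finset.mem_univ _, ?_⟩)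
  · by_cases hj : j ∈ s
    · have : hA.eigenvalues j < 1 := by simpa [hs] using hj
      exact mul_nonpos_of_nonpos_of_nonneg (by linarith) (sq_nonneg _)
    · simp [hg0 j hj]
  · have : hA.eigenvalues i.1 < 1 := (Finset.mem_filter.1 i.2).2
    rw [hg]
    exact mul_neg_of_neg_of_pos (by linarith) (by have : w i ≠ 0 := hi; positivity)

end Matrix.IsHermitian

/-! ### Building a tree leaf by leaf -/

namespace SimpleGraph

variable {V : Type*} (G : SimpleGraph V)

/-- The vertex sets obtained from a single vertex by repeatedly adding a vertex with exactly one
neighbour in the set. -/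
inductive LeafBuilt [DecidableEq V] : Finset V → Prop
  | singleton (r : V) : LeafBuilt {r}
  | insert {S : Finset V} {v u : V} : LeafBuilt S → v ∉ S → u ∈ S → G.Adj v u →
      (∀ w ∈ S, G.Adj v w → w = u) → LeafBuilt (Insert.insert v S)

variable {G} [DecidableEq V]

theorem LeafBuilt.reachable {H : SimpleGraph V} {S : Finset V} (hS : G.LeafBuilt S)
    (hH : ∀ a ∈ S, ∀ b ∈ S, G.Adj a b → H.Adj a b) :
    ∀ a ∈ S, ∀ b ∈ S, H.Reachable a b := by
  induction hS with
  | singleton r => simp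
  | @insert S v u _ _ hu huv _ ih =>
    have ih := ih fun a ha b hb => hH a (by simp [ha]) b (by simp [hb])
    have hvu : H.Reachable v u := (hH v (by simp) u (by simp [hu]) huv).reachable
    have key : ∀ a ∈ Insert.insert v S, H.Reachable a u := by
      intro a ha
      rcases Finset.mem_insert.1 ha with rfl | ha
      · exact hvu
      · exact ih a ha u hu
    exact fun a ha b hb => (key a ha).trans (key b hb).symm

theorem LeafBuilt.nonempty {S : Finset V} (hS : G.LeafBuilt S) : S.Nonempty := by
  cases hS <;> simp

theorem IsTree.leafBuilt_univ [Fintype V] (hG : G.IsTree) : G.LeafBuilt Finset.univ := by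
  obtain ⟨r⟩ := hG.connected.nonempty
  classical
  obtain ⟨S, hS, hmax⟩ := (Finset.univ.filter fun S : Finset V => G.LeafBuilt S).exists_max_image
    Finset.card ⟨{r}, by simp [LeafBuilt.singleton]⟩
  simp only [Finset.mem_filter, Finset.mem_univ, true_and] at hS hmax
  by_contra hne
  have hSu : S ≠ Finset.univ := by rintro rfl; exact hne hS
  obtain ⟨z, hz⟩ : ∃ z, z ∉ S := by
    by_contra! h; exact hSu (Finset.eq_univ_iff_forall.2 h)
  obtain ⟨a, ha⟩ := hS.nonempty
  obtain ⟨p⟩ := hG.connected.preconnected a z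
  obtain ⟨d, _, hd1, hd2⟩ := p.exists_boundary_dart (S : Set V) ha hz
  have hd1 : d.fst ∈ S := hd1
  have hd2 : d.snd ∉ S := hd2
  have hadj : G.Adj d.snd d.fst := d.adj.symm
  have hnew : G.LeafBuilt (insert d.snd S) := by
    -- A second neighbour in `S` would give a detour around the edge just crossed, which is a
    -- bridge.
    refine hS.insert hd2 hd1 hadj fun w hw hvw => ?_
    by_contra hwu
    refine (isBridge_iff.1 (isAcyclic_iff_forall_adj_isBridge.1 hG.isAcyclic hadj)) ?_
    have h1 : (G.deleteEdges {s(d.snd, d.fst)}).Adj d.snd w := by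
      simp only [deleteEdges_adj, Set.mem_singleton_iff, Sym2.eq_iff]
      exact ⟨hvw, by rintro (⟨_, h⟩ | ⟨h, _⟩); exacts [hwu h, hadj.ne h]⟩
    refine h1.reachable.trans (hS.reachable (fun a ha b hb hab => ?_) w hw _ hd1)
    simp only [deleteEdges_adj, Set.mem_singleton_iff, Sym2.eq_iff]
    exact ⟨hab, by rintro (⟨h, _⟩ | ⟨_, h⟩); exacts [hd2 (h ▸ ha), hd2 (h ▸ hb)]⟩
  have := hmax _ hnew
  rw [Finset.card_insert_of_notMem hd2] at this
  omega

end SimpleGraph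

/-! ### Weighted forms and elimination of a leaf -/

namespace SimpleGraph

variable {V : Type*} (G : SimpleGraph V) [DecidableRel G.Adj]

/-- The form `∑ (x i - x j) ^ 2` over the edges inside `S`, plus `∑ (τ i - 1) * x i ^ 2` over `S`.
A weight `⊤` stands for a coordinate that is required to vanish. -/
noncomputable def weightedForm (S : Finset V) (τ : V → WithTop ℝ) : QuadraticForm ℝ (V → ℝ) :=
  (1 / 2 : ℝ) • ∑ i ∈ S, ∑ j ∈ S,
    (if G.Adj i j then 1 else 0 : ℝ) •
      (QuadraticMap.sq (R := ℝ) (A := ℝ)).comp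
        ((LinearMap.proj i : (V → ℝ) →ₗ[ℝ] ℝ) - (LinearMap.proj j : (V → ℝ) →ₗ[ℝ] ℝ)) +
  ∑ i ∈ S, ((τ i).untopD 0 - 1) •
    (QuadraticMap.sq (R := ℝ) (A := ℝ)).comp (LinearMap.proj i : (V → ℝ) →ₗ[ℝ] ℝ)

variable {G}

theorem weightedForm_apply (S : Finset V) (τ : V → WithTop ℝ) (x : V → ℝ) :
    G.weightedForm S τ x =
      (∑ i ∈ S, ∑ j ∈ S, if G.Adj i j then (x i - x j) ^ 2 else 0) / 2 +
        ∑ i ∈ S, ((τ i).untopD 0 - 1) * x i ^ 2 := by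
  simp only [weightedForm, _root_.add_apply, _root_.smul_apply, _root_.sum_apply,
    QuadraticMap.comp_apply, QuadraticMap.sq_apply, LinearMap.sub_apply, LinearMap.proj_apply,
    smul_eq_mul, ite_mul, one_mul, zero_mul, sq]
  ring

theorem weightedForm_congr {S : Finset V} {τ : V → WithTop ℝ} {x y : V → ℝ}
    (h : ∀ i ∈ S, x i = y i) : G.weightedForm S τ x = G.weightedForm S τ y := by
  rw [weightedForm_apply, weightedForm_apply]
  congr 1
  · congr 1
    exact Finset.sum_congr rfl fun i hi => Finset.sum_congr rfl fun j hj => by rw [h i hi, h j hj]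
  · exact Finset.sum_congr rfl fun i hi => by rw [h i hi]

variable (G) in
/-- The weighted form on `S` is negative definite on a `k`-dimensional space of vectors that vanish
where the weight is `⊤`. -/
def HasNegDim (S : Finset V) (τ : V → WithTop ℝ) (k : ℕ) : Prop :=
  ∃ Φ : (Fin k → ℝ) →ₗ[ℝ] (V → ℝ),
    (∀ w, ∀ i ∈ S, τ i = ⊤ → Φ w i = 0) ∧ ∀ w, w ≠ 0 → G.weightedForm S τ (Φ w) < 0

theorem HasNegDim.zero (S : Finset V) (τ : V → WithTop ℝ) : G.HasNegDim S τ 0 :=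
  ⟨0, by simp, fun w hw => absurd (Subsingleton.elim w 0) hw⟩

theorem HasNegDim.singleton {r : V} {τ : V → WithTop ℝ} {a : ℝ} (hr : τ r = a) (ha : a < 1) :
    G.HasNegDim {r} τ 1 := by
  refine ⟨LinearMap.pi fun _ => LinearMap.proj 0, ?_, fun w hw => ?_⟩
  · simp [hr]
  · have h0 : w 0 ≠ 0 := fun h => hw (funext fun i => by rw [Subsingleton.elim i 0, h]; rfl)
    simp only [weightedForm_apply, Finset.sum_singleton, G.irrefl, if_false, hr,
      WithTop.untopD_coe, LinearMap.pi_apply, LinearMap.proj_apply]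
    have : 0 < w 0 ^ 2 := by positivity
    nlinarith

variable [DecidableEq V]

theorem weightedForm_insert {S : Finset V} {v u : V} (hv : v ∉ S) (hu : u ∈ S) (hvu : G.Adj v u)
    (huniq : ∀ w ∈ S, G.Adj v w → w = u) (τ : V → WithTop ℝ) (x : V → ℝ) :
    G.weightedForm (insert v S) τ x =
      G.weightedForm S τ x + (x v - x u) ^ 2 + ((τ v).untopD 0 - 1) * x v ^ 2 := by
  have h1 : (∑ j ∈ S, if G.Adj v j then (x v - x j) ^ 2 else 0) = (x v - x u) ^ 2 := by
    rw [Finset.sum_eq_single_of_mem u hu fun w hw hwu => if_neg fun h => hwu (huniq w hw h)]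
    exact if_pos hvu
  have h2 : (∑ j ∈ S, if G.Adj j v then (x j - x v) ^ 2 else 0) = (x v - x u) ^ 2 := by
    rw [← h1]
    refine Finset.sum_congr rfl fun j _ => ?_
    simp only [G.adj_comm j v, show (x j - x v) ^ 2 = (x v - x j) ^ 2 by ring]
  simp only [weightedForm_apply, Finset.sum_insert hv, Finset.sum_add_distrib, h1, h2, G.irrefl,
    if_false]
  ring

/-- Raising a weight only raises the form, so the neighbour's new weight may be rounded up, even to
`⊤`. -/
theorem weightedForm_add_le {S : Finset V} {u : V} (hu : u ∈ S) {τ : V → WithTop ℝ}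
    {β : WithTop ℝ} {c : ℝ} (hβ : τ u + c ≤ β) {x : V → ℝ} (hx : β = ⊤ → x u = 0) :
    G.weightedForm S τ x + c * x u ^ 2 ≤ G.weightedForm S (Function.update τ u β) x := by
  have key : ((τ u).untopD 0 - 1) * x u ^ 2 + c * x u ^ 2 ≤ (β.untopD 0 - 1) * x u ^ 2 := by
    induction β with
    | top => simp [hx rfl]
    | coe b =>
      cases h : τ u with
      | top => simp [h] at hβ
      | coe a =>
        rw [h] at hβ
        have hβ : a + c ≤ b := by exact_mod_cast hβ
        simp only [WithTop.untopD_coe]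
        nlinarith [sq_nonneg (x u)]
  simp only [weightedForm_apply]
  rw [← Finset.add_sum_erase S (fun i => ((τ i).untopD 0 - 1) * x i ^ 2) hu,
    ← Finset.add_sum_erase S
      (fun i => ((Function.update τ u β i).untopD 0 - 1) * x i ^ 2) hu,
    Function.update_self,
    Finset.sum_congr rfl (g := fun i => ((Function.update τ u β i).untopD 0 - 1) * x i ^ 2)
      (s₁ := S.erase u) fun i hi => by rw [Function.update_of_ne (Finset.ne_of_mem_erase hi)]]
  linarith

section Elimination

variable {S : Finset V} {v u : V} (hv : v ∉ S) (hu : u ∈ S) (hvu : G.Adj v u)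
  (huniq : ∀ w ∈ S, G.Adj v w → w = u) {τ : V → WithTop ℝ} {β : WithTop ℝ} {k : ℕ}
include hv hu hvu huniq

/-- Extending the vectors by `p * x u` at a leaf `v`. -/
theorem HasNegDim.insert_of_extension {c p : ℝ} (hβ : τ u + c ≤ β)
    (htop : τ v = ⊤ → p = 0)
    (hp : (p - 1) ^ 2 + ((τ v).untopD 0 - 1) * p ^ 2 ≤ c)
    (h : G.HasNegDim S (Function.update τ u β) k) : G.HasNegDim (insert v S) τ k := by
  obtain ⟨Φ, hΦ0, hΦ⟩ := h
  have hne : ∀ i ∈ S, i ≠ v := fun i hi h => hv (h ▸ hi)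
  refine ⟨LinearMap.pi fun i => if i = v then p • LinearMap.proj u ∘ₗ Φ else LinearMap.proj i ∘ₗ Φ,
    fun w i hi hτ => ?_, fun w hw => ?_⟩
  · rcases Finset.mem_insert.1 hi with rfl | hi
    · simp [htop hτ]
    · simp only [LinearMap.pi_apply, if_neg (hne i hi), LinearMap.comp_apply, LinearMap.proj_apply]
      apply hΦ0 w i hi
      by_cases hiu : i = u
      · subst hiu
        rw [hτ] at hβ
        simpa using hβ
      · rwa [Function.update_of_ne hiu]
  · have hx := weightedForm_add_le (G := G) hu hβ (x := Φ w) fun hb =>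
      hΦ0 w u hu (by rw [Function.update_self, hb])
    rw [weightedForm_insert hv hu hvu huniq, weightedForm_congr (y := Φ w) fun i hi => by
      simp [hne i hi]]
    simp only [LinearMap.pi_apply, if_neg (hne u hu), if_true, LinearMap.comp_apply,
      LinearMap.smul_apply, LinearMap.proj_apply, smul_eq_mul]
    nlinarith [hΦ w hw, mul_le_mul_of_nonneg_right hp (sq_nonneg (Φ w u))]

theorem HasNegDim.insert_of_pos {a : ℝ} (ha : τ v = a) (ha0 : 0 < a)
    (hβ : τ u + ((1 - 1 / a : ℝ) : WithTop ℝ) ≤ β)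
    (h : G.HasNegDim S (Function.update τ u β) k) : G.HasNegDim (insert v S) τ k := by
  refine h.insert_of_extension hv hu hvu huniq hβ (p := 1 / a) (by simp [ha]) (le_of_eq ?_)
  rw [ha, WithTop.untopD_coe]
  field_simp
  ring

theorem HasNegDim.insert_of_vanishing (hβ : τ u + ((1 : ℝ) : WithTop ℝ) ≤ β)
    (h : G.HasNegDim S (Function.update τ u β) k) : G.HasNegDim (insert v S) τ k :=
  h.insert_of_extension hv hu hvu huniq hβ (p := 0) (fun _ => rfl) (by norm_num)

theorem HasNegDim.insert_of_neg {a : ℝ} (ha : τ v = a) (ha0 : a < 0)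
    (hβ : τ u + ((1 - 1 / a : ℝ) : WithTop ℝ) ≤ β)
    (h : G.HasNegDim S (Function.update τ u β) k) : G.HasNegDim (insert v S) τ (k + 1) := by
  obtain ⟨Φ, hΦ0, hΦ⟩ := h
  have hne : ∀ i ∈ S, i ≠ v := fun i hi h => hv (h ▸ hi)
  let Ψ := Φ ∘ₗ LinearMap.funLeft ℝ ℝ Fin.succ
  have hΨ : ∀ w, Ψ w = Φ (fun i => w i.succ) := fun w => rfl
  -- The new parameter `w 0` is the completed square `x v - x u / a`.
  refine ⟨LinearMap.pi fun i => if i = v then LinearMap.proj 0 + (1 / a) • LinearMap.proj u ∘ₗ Ψ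
    else LinearMap.proj i ∘ₗ Ψ, fun w i hi hτ => ?_, fun w hw => ?_⟩
  · rcases Finset.mem_insert.1 hi with rfl | hi
    · simp [ha] at hτ
    · simp only [LinearMap.pi_apply, if_neg (hne i hi), LinearMap.comp_apply, LinearMap.proj_apply]
      apply hΦ0 _ i hi
      by_cases hiu : i = u
      · subst hiu
        rw [hτ] at hβ
        simpa using hβ
      · rwa [Function.update_of_ne hiu]
  · have hx := weightedForm_add_le (G := G) hu hβ (x := Ψ w) fun hb =>
      hΦ0 _ u hu (by rw [Function.update_self, hb])
    rw [weightedForm_insert hv hu hvu huniq, weightedForm_congr (y := Ψ w) fun i hi => by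
      simp [hne i hi]]
    simp only [LinearMap.pi_apply, if_neg (hne u hu), if_true, LinearMap.comp_apply,
      LinearMap.add_apply, LinearMap.smul_apply, LinearMap.proj_apply, smul_eq_mul, ha,
      WithTop.untopD_coe]
    have hsq : (w 0 + 1 / a * Ψ w u - Ψ w u) ^ 2 + (a - 1) * (w 0 + 1 / a * Ψ w u) ^ 2 =
        a * w 0 ^ 2 + (1 - 1 / a) * Ψ w u ^ 2 := by
      field_simp [ha0.ne]
      ring
    have key : a * w 0 ^ 2 + G.weightedForm S (Function.update τ u β) (Ψ w) < 0 := by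
      by_cases hw' : (fun i => w i.succ) = (0 : Fin k → ℝ)
      · have h0 : w 0 ≠ 0 := fun h0 => hw (funext fun i => by
          refine Fin.cases h0 (fun j => ?_) i
          exact congrFun hw' j)
        rw [hΨ, hw', map_zero, QuadraticMap.map_zero]
        have : 0 < w 0 ^ 2 := by positivity
        nlinarith
      · have := hΦ _ hw'
        rw [← hΨ] at this
        nlinarith [sq_nonneg (w 0)]
    linarith

theorem HasNegDim.insert_of_zero (ha : τ v = ((0 : ℝ) : WithTop ℝ)) (hτu : τ u ≠ ⊤)
    (h : G.HasNegDim S (Function.update τ u ⊤) k) : G.HasNegDim (insert v S) τ (k + 1) := by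
  obtain ⟨Φ, hΦ0, hΦ⟩ := h
  have hne : ∀ i ∈ S, i ≠ v := fun i hi h => hv (h ▸ hi)
  let Ψ := Φ ∘ₗ LinearMap.funLeft ℝ ℝ Fin.succ
  have hΨ : ∀ w, Ψ w = Φ (fun i => w i.succ) := fun w => rfl
  have hΨu : ∀ w, Ψ w u = 0 := fun w => hΦ0 _ u hu (by rw [Function.update_self])
  set Q := G.weightedForm S τ with hQ
  set e : V → ℝ := Pi.single u 1 with he
  -- With `x u = w 0`, the leaf contributes `w 0 ^ 2 - 2 * w 0 * x v`. This value of `x v` cancels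
  -- the cross term and leaves `-w 0 ^ 2`.
  let q : (Fin (k + 1) → ℝ) →ₗ[ℝ] ℝ :=
    (1 / 2 : ℝ) • (Q.polarBilin.flip e ∘ₗ Ψ) + ((Q e + 2) / 2) • LinearMap.proj 0
  have hq : ∀ w, q w = 1 / 2 * QuadraticMap.polar Q (Ψ w) e + (Q e + 2) / 2 * w 0 := fun w => rfl
  refine ⟨LinearMap.pi fun i => if i = v then q else
    LinearMap.proj i ∘ₗ Ψ + e i • LinearMap.proj 0, fun w i hi hτ => ?_, fun w hw => ?_⟩
  · rcases Finset.mem_insert.1 hi with rfl | hi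
    · simp [ha] at hτ
    · have hiu : i ≠ u := fun h => hτu (h ▸ hτ)
      simp only [LinearMap.pi_apply, if_neg (hne i hi), LinearMap.comp_apply, LinearMap.proj_apply,
        he, Pi.single_eq_of_ne hiu, zero_smul, add_zero]
      exact hΦ0 _ i hi (by rwa [Function.update_of_ne hiu])
  · rw [weightedForm_insert hv hu hvu huniq, weightedForm_congr (y := Ψ w + w 0 • e) fun i hi => by
      simp [hne i hi, mul_comm]]
    simp only [LinearMap.pi_apply, if_neg (hne u hu), if_true, LinearMap.comp_apply,
      LinearMap.add_apply, LinearMap.smul_apply, LinearMap.proj_apply, smul_eq_mul, ha,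
      WithTop.untopD_coe, hΨu]
    have heu : e u = 1 := by simp [he]
    have hexp : Q (Ψ w + w 0 • e) = Q (Ψ w) + w 0 ^ 2 * Q e +
        w 0 * QuadraticMap.polar Q (Ψ w) e := by
      rw [QuadraticMap.map_add Q, QuadraticMap.map_smul, QuadraticMap.polar_smul_right]
      simp only [smul_eq_mul]
      ring
    have hQle : Q (Ψ w) ≤ G.weightedForm S (Function.update τ u ⊤) (Ψ w) := by
      have := weightedForm_add_le (G := G) hu (c := 0) (le_top : τ u + ((0 : ℝ) : WithTop ℝ) ≤ ⊤)
        (x := Ψ w) fun _ => hΨu w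
      simpa using this
    rw [← hQ, hexp, heu, hq]
    have key : -w 0 ^ 2 + G.weightedForm S (Function.update τ u ⊤) (Ψ w) < 0 := by
      by_cases hw' : (fun i => w i.succ) = (0 : Fin k → ℝ)
      · have h0 : w 0 ≠ 0 := fun h0 => hw (funext fun i => by
          refine Fin.cases h0 (fun j => ?_) i
          exact congrFun hw' j)
        rw [hΨ, hw', map_zero, QuadraticMap.map_zero]
        have : 0 < w 0 ^ 2 := by positivity
        linarith
      · have := hΦ _ hw'
        rw [← hΨ] at this
        nlinarith [sq_nonneg (w 0)]
    nlinarith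

end Elimination

end SimpleGraph

/-! ### Greedy domination with budgets -/

namespace SimpleGraph

/-- The status of a vertex in the greedy construction of a dominating set: still to be dominated,
already dominated, or put into the set. -/
inductive DomClass
  | exposed
  | covered
  | chosen

namespace DomClass

/-- The diagonal weight attached to a vertex of the given class with budget `m`. -/
noncomputable def weight : DomClass → ℕ → WithTop ℝ
  | exposed, 2 => ((1 / 2 : ℝ) : WithTop ℝ)
  | exposed, 3 => ((2 / 3 : ℝ) : WithTop ℝ)
  | covered, 1 => ((1 : ℝ) : WithTop ℝ)
  | covered, 2 => ((2 : ℝ) : WithTop ℝ)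
  | covered, 3 => ((3 : ℝ) : WithTop ℝ)
  | chosen, 2 => ((-1 : ℝ) : WithTop ℝ)
  | _, _ + 4 => ⊤
  | _, _ => ((0 : ℝ) : WithTop ℝ)

/-- The least budget that occurs for a vertex of the given class. -/
def minBudget : DomClass → ℕ
  | exposed => 0
  | covered => 1
  | chosen => 2

/-- The class of a vertex after a neighbour has been chosen. -/
def cover : DomClass → DomClass
  | exposed => covered
  | c => c

theorem weight_eq_top {c : DomClass} {m : ℕ} (hm : 4 ≤ m) : c.weight m = ⊤ := by
  obtain ⟨n, rfl⟩ := Nat.exists_eq_add_of_le' hm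
  cases c <;> rfl

end DomClass

open DomClass

/-- A leaf of weight `α` can be eliminated, changing the weight of its neighbour from `β` to `β'`
and splitting off a negative definite space of dimension `g`. -/
def Eliminates (α β β' : WithTop ℝ) (g : ℕ) : Prop :=
  (β + ((1 : ℝ) : WithTop ℝ) ≤ β' ∧ g = 0) ∨
  (∃ a : ℝ, α = a ∧ 0 < a ∧ β + ((1 - 1 / a : ℝ) : WithTop ℝ) ≤ β' ∧ g = 0) ∨
  (∃ a : ℝ, α = a ∧ a < 0 ∧ β + ((1 - 1 / a : ℝ) : WithTop ℝ) ≤ β' ∧ g = 1) ∨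
  (α = ((0 : ℝ) : WithTop ℝ) ∧ β ≠ ⊤ ∧ β' = ⊤ ∧ g = 1)

theorem eliminates_top (α β : WithTop ℝ) : Eliminates α β ⊤ 0 := Or.inl ⟨le_top, rfl⟩

theorem eliminates_pos {a b b' : ℝ} (ha : 0 < a) (h : b + (1 - 1 / a) ≤ b') :
    Eliminates a b b' 0 :=
  Or.inr (Or.inl ⟨a, rfl, ha, by exact_mod_cast h, rfl⟩)

theorem eliminates_coe {α : WithTop ℝ} {b b' : ℝ} (h : b + 1 ≤ b') : Eliminates α b b' 0 :=
  Or.inl ⟨by exact_mod_cast h, rfl⟩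

/-- Choosing the neighbour is not charged yet; the 3 units are paid when it is stripped in turn. -/
theorem exists_eliminates_exposed (m l : ℕ) (d : DomClass) (hl : d.minBudget ≤ l) :
    ∃ l' g, 2 ≤ l' ∧ l' = m + l + 4 * g ∧
      Eliminates (exposed.weight m) (d.weight l) (chosen.weight l') g := by
  by_cases h4 : 4 ≤ m + l ∧ (2 ≤ m ∨ 4 ≤ l)
  · refine ⟨m + l, 0, by omega, rfl, ?_⟩
    rw [weight_eq_top h4.1]
    exact eliminates_top _ _
  · by_cases hm : m ≤ 1
    · have hl4 : l < 4 := by omega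
      refine ⟨m + l + 4, 1, by omega, rfl, Or.inr (Or.inr (Or.inr ⟨?_, ?_, ?_, rfl⟩))⟩
      · interval_cases m <;> rfl
      · cases d <;> interval_cases l <;> simp [weight]
      · exact weight_eq_top (by omega)
    · refine ⟨m + l, 0, by omega, rfl, ?_⟩
      have hm3 : m ≤ 3 := by omega
      have hl1 : l ≤ 1 := by omega
      cases d <;> simp only [minBudget] at hl <;> interval_cases m <;> interval_cases l <;>
        first
        | omega
        | exact eliminates_pos (by norm_num) (by norm_num)

theorem eliminates_covered {m l : ℕ} (hm : 1 ≤ m) {d : DomClass} (hl : d.minBudget ≤ l) :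
    Eliminates (covered.weight m) (d.weight l) (d.weight (m + l)) 0 := by
  by_cases h4 : 4 ≤ m + l
  · rw [weight_eq_top h4]
    exact eliminates_top _ _
  · have hm3 : m ≤ 3 := by omega
    have hl2 : l ≤ 2 := by omega
    cases d <;> simp only [minBudget] at hl <;> interval_cases m <;> interval_cases l <;>
      first
      | omega
      | exact eliminates_pos (by norm_num) (by norm_num)

theorem exists_eliminates_chosen {m l : ℕ} (hm : 2 ≤ m) {d : DomClass} (hl : d.minBudget ≤ l) :
    ∃ l' g, d.cover.minBudget ≤ l' ∧ l' + 3 = m + l + 4 * g ∧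
      Eliminates (chosen.weight m) (d.weight l) (d.cover.weight l') g := by
  have hd : d.cover.minBudget ≤ d.minBudget + 1 ∧ d.cover.minBudget ≤ 2 := by
    cases d <;> simp [cover, minBudget]
  by_cases hm4 : 4 ≤ m
  · refine ⟨m + l - 3, 0, by omega, by omega, ?_⟩
    by_cases h4 : 4 ≤ m + l - 3
    · rw [weight_eq_top h4]
      exact eliminates_top _ _
    · have hm3 : m ≤ 6 := by omega
      have hl2 : l ≤ 2 := by omega
      cases d <;> simp only [minBudget] at hl <;> interval_cases m <;> interval_cases l <;>
        first
        | omega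
        | exact eliminates_coe (by norm_num)
  · obtain rfl | rfl : m = 2 ∨ m = 3 := by omega
    · refine ⟨l + 3, 1, by omega, by omega, Or.inr (Or.inr (Or.inl ⟨-1, rfl, by norm_num, ?_, rfl⟩))⟩
      by_cases h4 : 4 ≤ l + 3
      · rw [weight_eq_top h4]
        exact le_top
      · obtain rfl : l = 0 := by omega
        cases d <;> simp only [minBudget] at hl <;>
          first
          | omega
          | exact (by exact_mod_cast (by norm_num : (0 : ℝ) + (1 - 1 / (-1)) ≤ 3) :
              ((0 : ℝ) : WithTop ℝ) + ((1 - 1 / (-1) : ℝ) : WithTop ℝ) ≤ ((3 : ℝ) : WithTop ℝ))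
    · by_cases h4 : 4 ≤ l
      · refine ⟨l, 0, by omega, by omega, ?_⟩
        rw [weight_eq_top h4, weight_eq_top h4]
        exact eliminates_top _ _
      · refine ⟨l + 4, 1, by omega, by omega, Or.inr (Or.inr (Or.inr ⟨rfl, ?_, ?_, rfl⟩))⟩
        · push Not at h4
          cases d <;> interval_cases l <;> simp [weight]
        · exact weight_eq_top (by omega)

variable {V : Type*} {G : SimpleGraph V} [DecidableRel G.Adj] [DecidableEq V]

theorem HasNegDim.insert_of_eliminates {S : Finset V} {v u : V} (hv : v ∉ S) (hu : u ∈ S)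
    (hvu : G.Adj v u) (huniq : ∀ w ∈ S, G.Adj v w → w = u) {τ : V → WithTop ℝ} {β : WithTop ℝ}
    {k g : ℕ} (he : Eliminates (τ v) (τ u) β g)
    (h : G.HasNegDim S (Function.update τ u β) k) : G.HasNegDim (insert v S) τ (k + g) := by
  rcases he with ⟨hβ, rfl⟩ | ⟨a, ha, ha0, hβ, rfl⟩ | ⟨a, ha, ha0, hβ, rfl⟩ | ⟨ha, hτu, rfl, rfl⟩
  · exact h.insert_of_vanishing hv hu hvu huniq hβ
  · exact h.insert_of_pos hv hu hvu huniq ha ha0 hβ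
  · exact h.insert_of_neg hv hu hvu huniq ha ha0 hβ
  · exact h.insert_of_zero hv hu hvu huniq ha hτu

/-- `D` contains the chosen vertices of `S` and dominates the exposed ones. -/
def DominatesClasses (G : SimpleGraph V) (S : Finset V) (c : V → DomClass) (D : Finset V) : Prop :=
  ∀ v ∈ S, (c v = chosen → v ∈ D) ∧ (c v = exposed → v ∈ D ∨ ∃ w ∈ D, G.Adj v w)

/-- Classes and budgets are arbitrary because stripping a leaf alters those of its neighbour. The `+
1` survives at the root: a covered root has budget at least 1, and any other root costs 3 against a
budget of at least 4 or a negative direction. -/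
theorem LeafBuilt.exists_dominatesClasses {S : Finset V} (hS : G.LeafBuilt S) :
    ∀ (c : V → DomClass) (m : V → ℕ), (∀ v ∈ S, (c v).minBudget ≤ m v) →
      ∃ (D : Finset V) (k : ℕ), G.DominatesClasses S c D ∧
        G.HasNegDim S (fun v => (c v).weight (m v)) k ∧ 3 * D.card + 1 ≤ 4 * k + ∑ v ∈ S, m v := by
  induction hS with
  | singleton r =>
    intro c m hm
    have hm := hm r (by simp)
    cases hc : c r with
    | covered =>
      refine ⟨∅, 0, by simp [DominatesClasses, hc], .zero _ _, ?_⟩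
      rw [hc] at hm
      simpa [minBudget] using hm
    | exposed =>
      by_cases h4 : 4 ≤ m r
      · exact ⟨{r}, 0, by simp [DominatesClasses, hc], .zero _ _, by simpa using h4⟩
      · refine ⟨{r}, 1, by simp [DominatesClasses, hc], ?_, by simp⟩
        obtain ⟨a, ha, ha1⟩ : ∃ a : ℝ, exposed.weight (m r) = a ∧ a < 1 := by
          generalize m r = l at *
          push Not at h4
          interval_cases l <;> exact ⟨_, rfl, by norm_num⟩
        exact .singleton (by rw [hc, ha]) ha1
    | chosen =>
      by_cases h4 : 4 ≤ m r
      · exact ⟨{r}, 0, by simp [DominatesClasses, hc], .zero _ _, by simpa using h4⟩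
      · refine ⟨{r}, 1, by simp [DominatesClasses, hc], ?_, by simp⟩
        obtain ⟨a, ha, ha1⟩ : ∃ a : ℝ, chosen.weight (m r) = a ∧ a < 1 := by
          generalize m r = l at *
          push Not at h4
          interval_cases l <;> exact ⟨_, rfl, by norm_num⟩
        exact .singleton (by rw [hc, ha]) ha1
  | @insert S v u _ hv hu hvu huniq ih =>
    intro c m hm
    have hmv := hm v (by simp)
    have hmu := hm u (by simp [hu])
    have hmS : ∀ w ∈ S, (c w).minBudget ≤ m w := fun w hw => hm w (by simp [hw])
    have hne : ∀ w ∈ S, w ≠ v := fun w hw h => hv (h ▸ hw)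
    -- The induction hypothesis, with the neighbour `u` moved to class `d` and budget `l`.
    have step : ∀ (d : DomClass) (l g : ℕ), d.minBudget ≤ l →
        Eliminates ((c v).weight (m v)) ((c u).weight (m u)) (d.weight l) g →
        ∃ (D : Finset V) (k : ℕ), G.DominatesClasses S (Function.update c u d) D ∧
          G.HasNegDim (Insert.insert v S) (fun w => (c w).weight (m w)) (k + g) ∧
          3 * D.card + 1 + m u ≤ 4 * k + ∑ w ∈ S, m w + l := by
      intro d l g hl he
      obtain ⟨D, k, hD, hk, hle⟩ := ih (Function.update c u d) (Function.update m u l) (by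
        intro w hw
        by_cases h : w = u
        · subst h; simpa using hl
        · simpa [Function.update_of_ne h] using hmS w hw)
      refine ⟨D, k, hD, HasNegDim.insert_of_eliminates hv hu hvu huniq he ?_, ?_⟩
      · convert hk using 1
        funext w
        by_cases h : w = u
        · subst h; simp
        · simp [Function.update_of_ne h]
      · rw [Finset.sum_update_of_mem hu] at hle
        have := Finset.sum_eq_add_sum_sdiff_singleton_of_mem hu m
        omega
    simp only [Finset.sum_insert hv]
    cases hc : c v with
    | exposed =>
      rw [hc] at step
      obtain ⟨l, g, hl, hlg, he⟩ := exists_eliminates_exposed (m v) (m u) (c u) hmu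
      obtain ⟨D, k, hD, hk, hle⟩ := step chosen l g hl he
      have huD : u ∈ D := (hD u hu).1 (by simp)
      refine ⟨D, k + g, fun w hw => ?_, hk, by omega⟩
      rcases Finset.mem_insert.1 hw with rfl | hw
      · exact ⟨by simp [hc], fun _ => Or.inr ⟨u, huD, hvu⟩⟩
      · by_cases h : w = u
        · subst h; exact ⟨fun _ => huD, fun _ => Or.inl huD⟩
        · simpa [Function.update_of_ne h] using hD w hw
    | covered =>
      rw [hc] at step hmv
      obtain ⟨D, k, hD, hk, hle⟩ := step (c u) (m v + m u) 0 (by omega) (eliminates_covered hmv hmu)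
      refine ⟨D, k, fun w hw => ?_, hk, by omega⟩
      rcases Finset.mem_insert.1 hw with rfl | hw
      · simp [hc]
      · simpa using hD w hw
    | chosen =>
      rw [hc] at step hmv
      obtain ⟨l, g, hl, hlg, he⟩ := exists_eliminates_chosen hmv hmu
      obtain ⟨D, k, hD, hk, hle⟩ := step (c u).cover l g hl he
      refine ⟨Insert.insert v D, k + g, fun w hw => ?_, hk, ?_⟩
      · rcases Finset.mem_insert.1 hw with rfl | hw
        · simp
        · by_cases h : w = u
          · subst h
            refine ⟨fun hcw => ?_, fun _ => Or.inr ⟨v, by simp, hvu.symm⟩⟩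
            exact Finset.mem_insert_of_mem ((hD w hw).1 (by simp [hcw, cover]))
          · have := hD w hw
            rw [Function.update_of_ne h] at this
            refine ⟨fun hcw => Finset.mem_insert_of_mem (this.1 hcw), fun hcw => ?_⟩
            exact (this.2 hcw).imp (Finset.mem_insert_of_mem ·)
              fun ⟨z, hz, hwz⟩ => ⟨z, Finset.mem_insert_of_mem hz, hwz⟩
      · have := Finset.card_insert_le v D
        omega

/-! ### Back to the Laplacian -/

section Laplacian

variable [Fintype V]

theorem dotProduct_lapMatrix_mulVec (x : V → ℝ) :
    x ⬝ᵥ (G.lapMatrix ℝ).mulVec x = (∑ i, ∑ j, if G.Adj i j then (x i - x j) ^ 2 else 0) / 2 := by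
  rw [← G.lapMatrix_toLinearMap₂' ℝ x, Matrix.toLinearMap₂'_apply']

theorem weightedForm_univ_zero (x : V → ℝ) :
    G.weightedForm Finset.univ (fun _ => ((0 : ℝ) : WithTop ℝ)) x =
      x ⬝ᵥ (G.lapMatrix ℝ).mulVec x - x ⬝ᵥ x := by
  rw [weightedForm_apply, dotProduct_lapMatrix_mulVec]
  simp [dotProduct, sq, sub_eq_add_neg]

open Classical in
theorem lapMu_eq : G.lapMu =
    (Finset.univ.filter fun i => (G.isHermitian_lapMatrix ℝ).eigenvalues i < 1).card := by
  unfold lapMu lapEigenvalueCount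
  congr 1
  ext i
  have : 0 ≤ (G.isHermitian_lapMatrix ℝ).eigenvalues i :=
    (G.posSemidef_lapMatrix ℝ).eigenvalues_nonneg i
  simp [this]

theorem lapMu_le_card {D : Finset V} (hD : G.IsDominatingSet D) : G.lapMu ≤ D.card := by
  rw [lapMu_eq]
  refine Matrix.IsHermitian.card_eigenvalues_lt_one_le _ D fun x hx => ?_
  rw [dotProduct_lapMatrix_mulVec, sub_nonneg, dotProduct,
    ← Finset.sum_add_sum_compl D fun i => x i * x i,
    Finset.sum_eq_zero fun i hi => by rw [hx i hi, zero_mul], zero_add, le_div_iff₀ two_pos]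
  set f : V → V → ℝ := fun i j => if G.Adj i j then (x i - x j) ^ 2 else 0 with hf
  have hf0 : ∀ i j, 0 ≤ f i j := fun i j => by simp only [hf]; split_ifs <;> positivity
  have hsymm : ∀ i j, f i j = f j i := fun i j => by
    simp only [hf, G.adj_comm j i, show (x j - x i) ^ 2 = (x i - x j) ^ 2 by ring]
  have h1 : ∑ i ∈ Dᶜ, x i * x i ≤ ∑ i ∈ Dᶜ, ∑ j ∈ D, f i j := by
    refine Finset.sum_le_sum fun i hi => ?_
    obtain ⟨u, hu, hiu⟩ := (hD i).resolve_left (Finset.mem_compl.1 hi)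
    calc x i * x i = f i u := by simp [hf, hiu, hx u hu, sq]
      _ ≤ _ := Finset.single_le_sum (f := f i) (fun j _ => hf0 i j) hu
  -- Each edge leaving `D` is counted in both orders, which absorbs the factor 1/2.
  have h2 : ∑ i ∈ D, ∑ j ∈ Dᶜ, f i j = ∑ i ∈ Dᶜ, ∑ j ∈ D, f i j := by
    rw [Finset.sum_comm]
    exact Finset.sum_congr rfl fun i _ => Finset.sum_congr rfl fun j _ => hsymm j i
  have h3 : ∑ i ∈ D, ∑ j ∈ Dᶜ, f i j ≤ ∑ i ∈ D, ∑ j, f i j :=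
    Finset.sum_le_sum fun i _ =>
      Finset.sum_le_sum_of_subset_of_nonneg (Finset.subset_univ _) fun j _ _ => hf0 i j
  have h4 : ∑ i ∈ Dᶜ, ∑ j ∈ D, f i j ≤ ∑ i ∈ Dᶜ, ∑ j, f i j :=
    Finset.sum_le_sum fun i _ =>
      Finset.sum_le_sum_of_subset_of_nonneg (Finset.subset_univ _) fun j _ _ => hf0 i j
  rw [← Finset.sum_add_sum_compl D]
  linarith

variable (G) in
theorem lapMu_le_dominationNumber : G.lapMu ≤ G.dominationNumber := by
  have hne : {k : ℕ | ∃ D : Finset V, G.IsDominatingSet D ∧ D.card = k}.Nonempty :=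
    ⟨_, Finset.univ, fun v => Or.inl (Finset.mem_univ v), rfl⟩
  obtain ⟨D, hD, hcard⟩ := Nat.sInf_mem hne
  exact (lapMu_le_card hD).trans hcard.le

theorem IsTree.three_mul_dominationNumber_lt (hG : G.IsTree) :
    3 * G.dominationNumber < 4 * G.lapMu := by
  obtain ⟨D, k, hD, ⟨Φ, -, hΦ⟩, hle⟩ :=
    hG.leafBuilt_univ.exists_dominatesClasses (fun _ => exposed) (fun _ => 0) (by simp [minBudget])
  have hk : k ≤ G.lapMu := by
    rw [lapMu_eq]
    refine Matrix.IsHermitian.le_card_eigenvalues_lt_one _ Φ fun w hw => ?_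
    rw [← weightedForm_univ_zero]
    exact hΦ w hw
  have hγ : G.dominationNumber ≤ D.card :=
    Nat.sInf_le ⟨D, fun v => (hD v (Finset.mem_univ v)).2 rfl, rfl⟩
  simp only [Finset.sum_const_zero] at hle
  omega

end Laplacian

end SimpleGraph

theorem theorem1 {V : Type*} [Fintype V] [DecidableEq V] (T : SimpleGraph V)
    [DecidableRel T.Adj] (hT : T.IsTree) :
    (1 : ℝ) ≤ (T.dominationNumber : ℝ) / (T.lapMu : ℝ) ∧
      (T.dominationNumber : ℝ) / (T.lapMu : ℝ) < 4 / 3 := by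
  have hlt := hT.three_mul_dominationNumber_lt
  have hpos : (0 : ℝ) < T.lapMu := by exact_mod_cast (by omega : 0 < T.lapMu)
  have hle : (T.lapMu : ℝ) ≤ T.dominationNumber := by exact_mod_cast T.lapMu_le_dominationNumber
  have hlt' : (3 : ℝ) * T.dominationNumber < 4 * T.lapMu := by exact_mod_cast hlt
  rw [one_le_div hpos, div_lt_iff₀ hpos]
  exact ⟨hle, by linarith⟩
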